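/- Let $K$ be a field, $n\ge 0$ and $S=K[x_1,\dots,x_n]$. A monomial ideal is an ideal generated by a set of monomials; $G_{\min}(I)$ denotes the unique minimal set of monomial generators of a monomial ideal $I$, i.e. the set of monomials in $I$ that are minimal with respect to divisibility. A monomial ideal $I$ is called lexsegment if, for all monomials $u,v$ of the same degree with $u\in I$ and $v>_{\mathrm{lex}}u$ (lexicographic order with $x_1>\cdots>x_n$), also $v\in I$; it is called universal lexsegment if for every $m\ge 0$ the ideal $I\,K[x_1,\dots,x_n,x_{n+1},\dots,x_{n+m}]$ is lexsegment. For an ideal $I$ and a prime ideal $P$ of $S$ put $$J(I,P)=\{f\in S \mid \text{there is } g\in S\setminus P \text{ with } fg\in I\}.$$ For a proper monomial ideal $L$ of $S$, $\operatorname{depth}(S/L)$ is the maximal length of an $S/L$-regular sequence contained in $(x_1,\dots,x_n)$. Let $I$ be a universal lexsegment ideal of $S$ and let $P$ be a prime monomial ideal of $S$ with $I\subseteq P$. Then $$\operatorname{depth}(S/I)\le \operatorname{depth}(S/J(I,P)),$$ and equality holds if and only if $x_i$ is a variable of $S$ lying in $P$ for every $1\le i\le |G_{\min}(I)|$, i.e.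 $\{x_1,\dots,x_{|G_{\min}(I)|}\}\subseteq P$. -/

import Mathlib

namespace LexIdeal

open MvPolynomial

/-- A monomial ideal: an ideal generated by a set of monomials
(a monomial is given by its exponent vector). -/
def IsMonomial {K : Type*} [Field K] {n : ℕ} (I : Ideal (MvPolynomial (Fin n) K)) : Prop :=
  ∃ A : Set (Fin n →₀ ℕ), I = Ideal.span ((fun a => monomial a (1 : K)) '' A)

/-- The exponent vectors of the minimal monomial generators of a monomial ideal `I`:
the monomials of `I` that are minimal with respect to divisibility. By the two lemmas below,
this is the unique minimal set of monomial generators of `I`. -/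
def minGens {K : Type*} [Field K] {n : ℕ} (I : Ideal (MvPolynomial (Fin n) K)) :
    Set (Fin n →₀ ℕ) :=
  {a | Minimal (fun b => monomial b (1 : K) ∈ I) a}

/-- Every set of monomials that generates `I` contains all the minimal generators. -/
theorem minGens_subset {K : Type*} [Field K] {n : ℕ} (I : Ideal (MvPolynomial (Fin n) K))
    (A : Set (Fin n →₀ ℕ)) (hA : I = Ideal.span ((fun a => monomial a (1 : K)) '' A)) :
    minGens I ⊆ A := by
  intro a ha
  replace ha : Minimal (fun b => monomial b (1 : K) ∈ I) a := ha
  have h1 : monomial a (1 : K) ∈ I := ha.prop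
  rw [hA, mem_ideal_span_monomial_image] at h1
  obtain ⟨s, hs, hle⟩ := h1 a (by classical simp [support_monomial])
  have h2 : monomial s (1 : K) ∈ I := by
    rw [hA]; exact Ideal.subset_span ⟨s, hs, rfl⟩
  have h3 : a = s := le_antisymm (ha.le_of_le h2 hle) hle
  rwa [h3]

/-- The minimal generators of a monomial ideal generate it. -/
theorem span_minGens {K : Type*} [Field K] {n : ℕ} (I : Ideal (MvPolynomial (Fin n) K))
    (hI : IsMonomial I) :
    Ideal.span ((fun a => monomial a (1 : K)) '' minGens I) = I := by
  obtain ⟨A, hA⟩ := hI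
  apply le_antisymm
  · rw [Ideal.span_le]
    rintro _ ⟨a, ha, rfl⟩
    exact Minimal.prop (P := fun b => monomial b (1 : K) ∈ I) ha
  · intro f hf
    rw [hA, mem_ideal_span_monomial_image] at hf
    rw [mem_ideal_span_monomial_image]
    intro x hx
    obtain ⟨s, hs, hle⟩ := hf x hx
    have h2 : monomial s (1 : K) ∈ I := by
      rw [hA]; exact Ideal.subset_span ⟨s, hs, rfl⟩
    obtain ⟨t, hts, ht⟩ :=
      exists_minimal_le_of_wellFoundedLT (fun b => monomial b (1 : K) ∈ I) s h2
    exact ⟨t, ht, hts.trans hle⟩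

/-- A lexsegment ideal: a monomial ideal `I` such that, for monomials `u`, `v` of the same degree
with `u ∈ I` and `v` greater than `u` in the lexicographic order induced by
`x₁ > x₂ > ⋯ > xₙ`, also `v ∈ I`. -/
def IsLexsegment {K : Type*} [Field K] {n : ℕ} (I : Ideal (MvPolynomial (Fin n) K)) : Prop :=
  IsMonomial I ∧ ∀ u v : Fin n →₀ ℕ, u.degree = v.degree → toLex u < toLex v →
    monomial u (1 : K) ∈ I → monomial v (1 : K) ∈ I

/-- A universal lexsegment ideal of `K[x₁, …, xₙ]`: a monomial ideal whose extension to
`K[x₁, …, xₙ, xₙ₊₁, …, xₙ₊ₘ]` is a lexsegment ideal for every `m ≥ 0`. -/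
def IsUniversalLexsegment {K : Type*} [Field K] {n : ℕ}
    (I : Ideal (MvPolynomial (Fin n) K)) : Prop :=
  IsMonomial I ∧ ∀ m : ℕ, IsLexsegment
    (I.map (rename (R := K) (Fin.castAdd m : Fin n → Fin (n + m))))

/-- `J(I, P) = {f | ∃ g ∉ P, f g ∈ I}`, the kernel of `R → (R ⧸ I)_P`. -/
def idealJ {R : Type*} [CommRing R] (I P : Ideal R) [P.IsPrime] : Ideal R where
  carrier := {f | ∃ g, g ∉ P ∧ f * g ∈ I}
  zero_mem' := ⟨1, (Ideal.ne_top_iff_one P).mp Ideal.IsPrime.ne_top', by simp⟩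
  add_mem' := by
    rintro a b ⟨g, hg, hag⟩ ⟨h, hh, hbh⟩
    refine ⟨g * h, fun hgh => (Ideal.IsPrime.mem_or_mem ‹_› hgh).elim hg hh, ?_⟩
    have e : (a + b) * (g * h) = h * (a * g) + g * (b * h) := by ring
    rw [e]
    exact I.add_mem (I.mul_mem_left _ hag) (I.mul_mem_left _ hbh)
  smul_mem' := by
    rintro c a ⟨g, hg, hag⟩
    refine ⟨g, hg, ?_⟩
    rw [smul_eq_mul, mul_assoc]
    exact I.mul_mem_left _ hag

/-- The depth (grade) of the module `M` with respect to the ideal `𝔪`: the supremum of the lengths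
of the `M`-regular sequences whose elements lie in `𝔪`. -/
noncomputable def depthOn {R : Type*} [CommRing R] (𝔪 : Ideal R) (M : Type*) [AddCommGroup M]
    [Module R M] : ℕ∞ :=
  ⨆ (rs : List R) (_ : (∀ r ∈ rs, r ∈ 𝔪) ∧ RingTheory.Sequence.IsRegular M rs), (rs.length : ℕ∞)

/-- `depth (S / I)` for a proper monomial ideal `I` of `S = K[x₁, …, xₙ]`: the depth of the graded
`S`-module `S / I` with respect to the graded maximal ideal `(x₁, …, xₙ)`. -/
noncomputable def depthQuot {K : Type*} [Field K] {n : ℕ}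
    (I : Ideal (MvPolynomial (Fin n) K)) : ℕ∞ :=
  depthOn (idealOfVars (Fin n) K) (MvPolynomial (Fin n) K ⧸ I)

end LexIdeal

/-! Index variables from 0. A nonzero universal lexsegment ideal is `lexIdeal K c`: with an extra
last variable to absorb differences of degree, its monomials are closed upwards in lex across
degrees, and lex on exponent vectors is a well-order, so they are exactly those above a least one,
`c`.

Let `k` be the last index with `c k ≠ 0`. The ideal then has `k + 1` minimal generators
(`ncard_minGens_lexIdeal`) and depth `n - (k + 1)`. The depth is at most this because the first `k +
1` variables generate an associated prime, and each term of a regular sequence pushes an associated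
prime strictly up. It is at least this because the later variables form a regular sequence.

If `P` contains the first `k + 1` variables, then `J(I, P) = I`. Otherwise let `x_s` be the first
variable outside `P`; inverting it truncates `c` before `s ≤ k`, so the depth rises to at least `n -
s > n - (k + 1)`. -/

/-! ### Depth and associated primes -/

open scoped Pointwise in
/-- If `x ∈ 𝔪` is regular on `M`, an associated prime of `M` inside `𝔪` is strictly contained in an
associated prime of `M ⧸ x M` inside `𝔪`. -/
theorem exists_associatedPrime_quotSMulTop_gt {R M : Type*} [CommRing R] [IsNoetherianRing R]
    [AddCommGroup M] [Module R M] [Module.Finite R M] {𝔪 p : Ideal R} [h𝔪 : 𝔪.IsPrime]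
    (hp : p ∈ associatedPrimes R M) (hp𝔪 : p ≤ 𝔪) {x : R} (hx : x ∈ 𝔪) (hreg : IsSMulRegular M x) :
    ∃ q ∈ associatedPrimes R (QuotSMulTop x M), p < q ∧ q ≤ 𝔪 := by
  obtain ⟨hpp, z₀, hz₀⟩ := isAssociatedPrime_iff.1 hp
  have hz₀' : ∀ r, r ∈ p ↔ r • z₀ = 0 := fun r => by
    rw [hz₀, Submodule.mem_colon_singleton, Submodule.mem_bot]
  let N : Submodule R M := Submodule.torsionBySet R M (p : Set R)
  have hN : ∀ z, z ∈ N ↔ ∀ r ∈ p, r • z = 0 := fun z => by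
    simp [N, Submodule.mem_torsionBySet_iff]
  have hz₀N : z₀ ∈ N := (hN _).2 fun r hr => (hz₀' r).1 hr
  have hxp : x ∉ p := fun h => by
    have h0 : z₀ = 0 := hreg.right_eq_zero_of_smul ((hz₀' x).1 h)
    exact hpp.one_notMem ((hz₀' 1).2 (by rw [h0, smul_zero]))
  -- Otherwise finite generation of `N` gives one `σ ∉ 𝔪` with `σ N ⊆ x M`; Cayley–Hamilton then
  -- forces a power of `σ` into `𝔪`.
  have key : ∃ z ∈ N, ∀ s, s • z ∈ x • (⊤ : Submodule R M) → s ∈ 𝔪 := by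
    by_contra! hcon
    choose! s hs hs𝔪 using hcon
    obtain ⟨T, hT⟩ := (IsNoetherian.noetherian N : N.FG)
    have hTN : ∀ z ∈ T, z ∈ N := fun z hz => hT ▸ Submodule.subset_span hz
    let σ := ∏ z ∈ T, s z
    have hσ : σ ∉ 𝔪 := fun h => by
      obtain ⟨z, hz, h⟩ := (Ideal.IsPrime.prod_mem_iff).1 h
      exact hs𝔪 z (hTN z hz) h
    have hσN : ∀ z ∈ N, σ • z ∈ x • (⊤ : Submodule R M) := by
      have : N ≤ (x • (⊤ : Submodule R M)).comap (LinearMap.lsmul R M σ) := by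
        rw [← hT, Submodule.span_le]
        intro z hz
        obtain ⟨c, hc⟩ := Finset.dvd_prod_of_mem s hz
        simp only [Submodule.comap_coe, Set.mem_preimage, LinearMap.lsmul_apply, SetLike.mem_coe]
        rw [show σ = c * s z by rw [mul_comm]; exact hc, mul_smul]
        exact Submodule.smul_mem _ _ (hs z (hTN z hz))
      exact fun z hz => this hz
    -- `σ N ⊆ x M` improves to `σ N ⊆ x N`: if `σ z = x y`, regularity of `x` makes `p` kill `y`.
    have hrange : LinearMap.range (algebraMap R (Module.End R N) σ) ≤
        Ideal.span {x} • (⊤ : Submodule R N) := by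
      rintro _ ⟨z, rfl⟩
      obtain ⟨y, -, hy⟩ := (Submodule.mem_smul_pointwise_iff_exists _ _ _).1 (hσN z z.2)
      have hyN : y ∈ N := (hN y).2 fun r hr => by
        apply hreg.right_eq_zero_of_smul
        rw [smul_comm, hy, smul_comm, (hN z).1 z.2 r hr, smul_zero]
      rw [Submodule.ideal_span_singleton_smul]
      refine (Submodule.mem_smul_pointwise_iff_exists _ _ _).2 ⟨⟨y, hyN⟩, trivial, ?_⟩
      ext
      simpa [Module.algebraMap_end_apply] using hy
    obtain ⟨f, hf, -, hcoeff, hf0⟩ :=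
      LinearMap.exists_monic_and_natDegree_eq_and_coeff_mem_pow_and_aeval_eq_zero R
        (algebraMap R (Module.End R N) σ) (Ideal.span {x}) hrange
    rw [Polynomial.aeval_algebraMap_apply_eq_algebraMap_eval] at hf0
    have hev : f.eval σ ∈ 𝔪 := by
      apply hp𝔪
      rw [hz₀']
      have := congrArg Subtype.val (LinearMap.congr_fun hf0 ⟨z₀, hz₀N⟩)
      simpa [Module.algebraMap_end_apply] using this
    have hmap : f.map (Ideal.Quotient.mk 𝔪) = Polynomial.X ^ f.natDegree := by
      ext k
      rw [Polynomial.coeff_map, Polynomial.coeff_X_pow]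
      split_ifs with hk
      · rw [hk, hf.coeff_natDegree, map_one]
      · rw [Ideal.Quotient.eq_zero_iff_mem]
        rcases lt_or_gt_of_ne hk with h | h
        · have hle : Ideal.span {x} ^ (f.natDegree - k) ≤ 𝔪 :=
            (Ideal.pow_le_self (by omega)).trans ((Ideal.span_singleton_le_iff_mem _).2 hx)
          exact hle (hcoeff k)
        · rw [Polynomial.coeff_eq_zero_of_natDegree_lt h]
          exact 𝔪.zero_mem
    apply hσ
    apply h𝔪.mem_of_pow_mem f.natDegree
    rw [← Ideal.Quotient.eq_zero_iff_mem] at hev ⊢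
    rw [map_pow, ← hev, ← Polynomial.eval_map_apply, hmap, Polynomial.eval_pow, Polynomial.eval_X]
  obtain ⟨z, hzN, hz⟩ := key
  let zb : QuotSMulTop x M := Submodule.Quotient.mk z
  have hann : ∀ r, r ∈ Module.annihilator R (Submodule.span R {zb}) ↔
      r • z ∈ x • (⊤ : Submodule R M) := fun r => by
    rw [← Submodule.annihilator, Submodule.mem_annihilator_span_singleton,
      ← Submodule.Quotient.mk_smul, Submodule.Quotient.mk_eq_zero]
  obtain ⟨q, hq, hq𝔪⟩ := Ideal.exists_minimalPrimes_le
    (I := Module.annihilator R (Submodule.span R {zb})) (J := 𝔪) fun r hr => hz r ((hann r).1 hr)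
  refine ⟨q, associatedPrimes.subset_of_injective (Submodule.subtype_injective _)
    (Module.associatedPrimes.minimalPrimes_annihilator_subset_associatedPrimes R _ hq), ?_, hq𝔪⟩
  refine lt_of_le_of_ne (fun r hr => hq.1.2 ((hann r).2 ?_)) ?_
  · rw [(hN z).1 hzN r hr]
    exact Submodule.zero_mem _
  · rintro rfl
    exact hxp (hq.1.2 ((hann x).2 (Submodule.smul_mem_pointwise_smul _ _ _ trivial)))

/-- The length of a weakly regular sequence in `𝔪` is at most the dimension of `R ⧸ p` for every
associated prime `p` inside `𝔪`. -/
theorem length_le_coheight_of_isWeaklyRegular {R : Type*} [CommRing R] [IsNoetherianRing R]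
    {𝔪 : Ideal R} [𝔪.IsPrime] (rs : List R) : ∀ {M : Type*} [AddCommGroup M] [Module R M]
    [Module.Finite R M] {p : Ideal R} (hp : p ∈ associatedPrimes R M), p ≤ 𝔪 →
    (∀ r ∈ rs, r ∈ 𝔪) → RingTheory.Sequence.IsWeaklyRegular M rs →
    (rs.length : ℕ∞) ≤ Order.coheight (⟨p, hp.1⟩ : PrimeSpectrum R) := by
  induction rs with
  | nil => intros; simp
  | cons r rs ih =>
    intro M _ _ _ p hp hp𝔪 hrs hreg
    rw [RingTheory.Sequence.isWeaklyRegular_cons_iff] at hreg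
    obtain ⟨q, hq, hpq, hq𝔪⟩ := exists_associatedPrime_quotSMulTop_gt hp hp𝔪
      (hrs r (by simp)) hreg.1
    have h1 := ih hq hq𝔪 (fun s hs => hrs s (by simp [hs])) hreg.2
    have h2 : (⟨p, hp.1⟩ : PrimeSpectrum R) < ⟨q, hq.1⟩ := hpq
    calc ((r :: rs).length : ℕ∞) = rs.length + 1 := by simp
      _ ≤ Order.coheight (⟨q, hq.1⟩ : PrimeSpectrum R) + 1 := by gcongr
      _ ≤ _ := Order.coheight_add_one_le h2

namespace LexIdeal

open MvPolynomial

variable {K : Type*} [Field K] {n : ℕ}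

/-! ### Lexicographic comparison of exponent vectors -/

section Lex

variable {c m m' : Fin n →₀ ℕ}

theorem toLex_le_iff : toLex c ≤ toLex m ↔
    c = m ∨ ∃ i, (∀ j < i, c j = m j) ∧ c i < m i := by
  rw [le_iff_eq_or_lt, Finsupp.Lex.lt_iff, toLex_inj]
  rfl

theorem toLex_le_of_le (h : c ≤ m) : toLex c ≤ toLex m := Finsupp.toLex_monotone h

/-- If `c` only involves the first `r` variables, then `c ≤ m` in the lexicographic order only
depends on the first `r` entries of `m`. -/
theorem toLex_le_congr {r : ℕ} (hc : ∀ i : Fin n, r ≤ i → c i = 0)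
    (hm : ∀ i : Fin n, i < r → m i = m' i) (h : toLex c ≤ toLex m) : toLex c ≤ toLex m' := by
  rcases toLex_le_iff.1 h with rfl | ⟨i, hi, hlt⟩
  · refine toLex_le_of_le fun i => ?_
    rcases lt_or_ge (i : ℕ) r with h | h
    · exact (hm i h).le
    · simp [hc i h]
  · rcases lt_or_ge (i : ℕ) r with h | h
    · refine toLex_le_iff.2 (Or.inr ⟨i, fun j hj => ?_, ?_⟩)
      · rw [hi j hj, hm j ((Fin.lt_def.1 hj).trans h)]
      · rwa [← hm i h]
    · refine toLex_le_of_le fun j => ?_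
      rcases lt_or_ge (j : ℕ) r with h' | h'
      · rw [hi j (Fin.lt_def.2 (h'.trans_le h)), hm j h']
      · simp [hc j h']

/-- The truncation of `c` to the entries before `s` is lexicographically below `c`. -/
theorem filter_lt_le (c : Fin n →₀ ℕ) (s : Fin n) : c.filter (· < s) ≤ c := fun i => by
  by_cases h : i < s
  · exact (Finsupp.filter_apply_pos (· < s) c h).le
  · exact (Finsupp.filter_apply_neg (· < s) c h).trans_le (Nat.zero_le _)

end Lex

/-! ### Primes generated by variables -/

section PrimeVars

/-- An ideal generated by variables is prime. -/
theorem isPrime_span_X_image (s : Set (Fin n)) :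
    (Ideal.span (X '' s : Set (MvPolynomial (Fin n) K))).IsPrime := by
  classical
  let φ : MvPolynomial (Fin n) K →ₐ[K] MvPolynomial (Fin n) K :=
    aeval fun i => if i ∈ s then 0 else X i
  let π := Ideal.Quotient.mkₐ K (Ideal.span (X '' s : Set (MvPolynomial (Fin n) K)))
  have hπ : π.comp φ = π := by
    ext i
    by_cases hi : i ∈ s
    · have : π (X i) = 0 :=
        Ideal.Quotient.eq_zero_iff_mem.2 (Ideal.subset_span (Set.mem_image_of_mem _ hi))
      simp [φ, hi, this]
    · simp [φ, hi]
  have hker : Ideal.span (X '' s : Set (MvPolynomial (Fin n) K)) = RingHom.ker φ := by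
    apply le_antisymm
    · rw [Ideal.span_le]
      rintro _ ⟨i, hi, rfl⟩
      simp [φ, hi]
    · intro f hf
      have h1 : π f = 0 := by
        rw [← hπ, AlgHom.comp_apply, RingHom.mem_ker.1 hf, map_zero]
      exact Ideal.Quotient.eq_zero_iff_mem.1 h1
  rw [hker]
  exact RingHom.ker_isPrime _

variable (K) in
/-- The prime ideal generated by the first `t` variables. -/
noncomputable def varsLT (n t : ℕ) : Ideal (MvPolynomial (Fin n) K) :=
  Ideal.span (X '' {i : Fin n | (i : ℕ) < t})

theorem mem_varsLT {t : ℕ} {f : MvPolynomial (Fin n) K} :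
    f ∈ varsLT K n t ↔ ∀ m ∈ f.support, ∃ i : Fin n, (i : ℕ) < t ∧ m i ≠ 0 :=
  mem_ideal_span_X_image

instance isPrime_varsLT (t : ℕ) : (varsLT K n t).IsPrime := isPrime_span_X_image _

theorem X_mem_varsLT {t : ℕ} {i : Fin n} :
    (X i : MvPolynomial (Fin n) K) ∈ varsLT K n t ↔ (i : ℕ) < t := by
  classical
  rw [mem_varsLT, support_X]
  simp [Finsupp.single_apply]

theorem varsLT_le_iff {t : ℕ} {P : Ideal (MvPolynomial (Fin n) K)} :
    varsLT K n t ≤ P ↔ ∀ i : Fin n, (i : ℕ) < t → X i ∈ P := by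
  simp [varsLT, Ideal.span_le, Set.subset_def]

instance isPrime_idealOfVars : (idealOfVars (Fin n) K).IsPrime := by
  rw [idealOfVars, ← Set.image_univ]
  exact isPrime_span_X_image _

theorem varsLT_le_idealOfVars (t : ℕ) : varsLT K n t ≤ idealOfVars (Fin n) K :=
  Ideal.span_mono (Set.image_subset_range _ _)

/-- Each new variable gives a strictly larger prime, costing one from the Krull dimension `n`. -/
theorem add_coheight_varsLT_le (t : ℕ) (ht : t ≤ n) :
    t + Order.coheight (⟨varsLT K n t, inferInstance⟩ : PrimeSpectrum (MvPolynomial (Fin n) K)) ≤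
      n := by
  induction t with
  | zero =>
    have h1 := Order.coheight_le_krullDim
      (⟨varsLT K n 0, inferInstance⟩ : PrimeSpectrum (MvPolynomial (Fin n) K))
    have h2 : ringKrullDim (MvPolynomial (Fin n) K) = n := by
      simp [MvPolynomial.ringKrullDim_of_isNoetherianRing]
    rw [← ringKrullDim, h2] at h1
    rw [Nat.cast_zero, zero_add]
    exact_mod_cast h1
  | succ t ih =>
    have hlt : (⟨varsLT K n t, inferInstance⟩ : PrimeSpectrum (MvPolynomial (Fin n) K)) <
        ⟨varsLT K n (t + 1), inferInstance⟩ := by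
      change varsLT K n t < varsLT K n (t + 1)
      refine lt_of_le_of_ne (varsLT_le_iff.2 fun i hi => X_mem_varsLT.2 (by omega)) fun h => ?_
      have : (X ⟨t, ht⟩ : MvPolynomial (Fin n) K) ∈ varsLT K n t := by
        rw [h]; exact X_mem_varsLT.2 (Nat.lt_succ_self t)
      exact lt_irrefl t (X_mem_varsLT.1 this)
    refine le_trans ?_ (ih (by omega))
    rw [Nat.cast_succ, add_assoc, add_comm 1]
    gcongr
    exact Order.coheight_add_one_le hlt

end PrimeVars

/-! ### Lex ideals and their localizations -/

section LexIdeal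

variable {c : Fin n →₀ ℕ}

variable (K) in
/-- The ideal generated by all monomials that are at least `c` in the lexicographic order
(regardless of the degree). -/
noncomputable def lexIdeal (c : Fin n →₀ ℕ) : Ideal (MvPolynomial (Fin n) K) :=
  Ideal.span ((fun a => monomial a (1 : K)) '' {v | toLex c ≤ toLex v})

theorem mem_lexIdeal {f : MvPolynomial (Fin n) K} :
    f ∈ lexIdeal K c ↔ ∀ m ∈ f.support, toLex c ≤ toLex m := by
  rw [lexIdeal, mem_ideal_span_monomial_image]
  refine forall₂_congr fun m _ => ⟨?_, fun h => ⟨m, h, le_rfl⟩⟩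
  rintro ⟨v, hv, hvm⟩
  exact le_trans hv (toLex_le_of_le hvm)

theorem monomial_mem_lexIdeal {m : Fin n →₀ ℕ} :
    monomial m (1 : K) ∈ lexIdeal K c ↔ toLex c ≤ toLex m := by
  classical simp [mem_lexIdeal, support_monomial]

/-- If `c` only involves the first `r` variables, polynomials outside `(x₁, …, xᵣ)` are not zero
divisors modulo `lexIdeal K c`. -/
theorem mem_lexIdeal_of_mul_mem {r : ℕ} (hc : ∀ i : Fin n, r ≤ i → c i = 0)
    {f g : MvPolynomial (Fin n) K} (hg : g ∉ varsLT K n r) (hfg : f * g ∈ lexIdeal K c) :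
    f ∈ lexIdeal K c := by
  classical
  by_contra hf
  rw [mem_lexIdeal] at hf
  push Not at hf
  obtain ⟨a₀, ha₀, hca₀⟩ := hf
  -- Take the lex-least monomial `a` of `f` below `c` and the lex-least `b` of `g`: `a + b` then
  -- survives in `f * g`. As `b` avoids the first `r` variables, `c ≤ a + b` would give `c ≤ a`.
  obtain ⟨a, ha, hamin⟩ := Finset.exists_min_image
    (f.support.filter fun m => toLex m < toLex c) (fun m => toLex m)
    ⟨a₀, Finset.mem_filter.2 ⟨ha₀, hca₀⟩⟩
  rw [Finset.mem_filter] at ha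
  rw [mem_varsLT] at hg
  push Not at hg
  obtain ⟨b₀, hb₀, hb₀r⟩ := hg
  obtain ⟨b, hb, hbmin⟩ := Finset.exists_min_image g.support (fun m => toLex m) ⟨b₀, hb₀⟩
  have hbr : ∀ i : Fin n, (i : ℕ) < r → b i = 0 := by
    intro i hi
    rcases toLex_le_iff.1 (hbmin b₀ hb₀) with rfl | ⟨j, hj, hlt⟩
    · exact hb₀r i hi
    · have hjr : r ≤ (j : ℕ) := by
        by_contra h
        rw [hb₀r j (not_le.1 h)] at hlt
        exact Nat.not_lt_zero _ hlt
      rw [hj i (Fin.lt_def.2 (hi.trans_le hjr)), hb₀r i hi]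
  have hcoeff : coeff (a + b) (f * g) = coeff a f * coeff b g := by
    rw [coeff_mul]
    refine Finset.sum_eq_single (a, b) ?_ (by simp)
    rintro ⟨a', b'⟩ hab hne
    replace hab : a' + b' = a + b := Finset.HasAntidiagonal.mem_antidiagonal.1 hab
    by_contra hprod
    have ha' : a' ∈ f.support := mem_support_iff.2 (left_ne_zero_of_mul hprod)
    have hb' : b' ∈ g.support := mem_support_iff.2 (right_ne_zero_of_mul hprod)
    have hsum : toLex a' + toLex b' = toLex a + toLex b := congrArg toLex hab
    have h1 : toLex b ≤ toLex b' := hbmin b' hb'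
    have h2 : toLex a' ≤ toLex a := by
      by_contra h
      exact (add_lt_add_of_lt_of_le (not_le.1 h) h1).ne' hsum
    have h3 : toLex a ≤ toLex a' :=
      hamin a' (Finset.mem_filter.2 ⟨ha', h2.trans_lt ha.2⟩)
    have h4 : a' = a := toLex_inj.1 (le_antisymm h2 h3)
    subst h4
    exact hne (Prod.ext rfl (add_left_cancel hab))
  have hmem : a + b ∈ (f * g).support := by
    rw [mem_support_iff, hcoeff]
    exact mul_ne_zero (mem_support_iff.1 ha.1) (mem_support_iff.1 hb)
  refine ha.2.not_ge (toLex_le_congr hc (fun i hi => ?_) (mem_lexIdeal.1 hfg _ hmem))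
  simp [hbr i hi]

theorem lexIdeal_mono {c c' : Fin n →₀ ℕ} (h : c' ≤ c) : lexIdeal K c ≤ lexIdeal K c' :=
  fun _ hf => mem_lexIdeal.2 fun m hm => (toLex_le_of_le h).trans (mem_lexIdeal.1 hf m hm)

theorem le_idealJ {R : Type*} [CommRing R] (I P : Ideal R) [P.IsPrime] : I ≤ idealJ I P :=
  fun f hf => ⟨1, (Ideal.ne_top_iff_one P).mp Ideal.IsPrime.ne_top', by simpa using hf⟩

theorem idealJ_le {R : Type*} [CommRing R] {I P : Ideal R} [P.IsPrime] (h : I ≤ P) :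
    idealJ I P ≤ P := by
  rintro f ⟨g, hg, hfg⟩
  exact (Ideal.IsPrime.mem_or_mem ‹_› (h hfg)).resolve_right hg

theorem idealJ_lexIdeal_eq_self {P : Ideal (MvPolynomial (Fin n) K)} [P.IsPrime] {r : ℕ}
    (hc : ∀ i : Fin n, r ≤ i → c i = 0) (hP : varsLT K n r ≤ P) :
    idealJ (lexIdeal K c) P = lexIdeal K c := by
  refine le_antisymm ?_ (le_idealJ _ _)
  rintro f ⟨g, hg, hfg⟩
  exact mem_lexIdeal_of_mul_mem hc (fun h => hg (hP h)) hfg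

theorem idealJ_lexIdeal_eq_filter {P : Ideal (MvPolynomial (Fin n) K)} [P.IsPrime] {s : Fin n}
    (hP : varsLT K n s ≤ P) (hs : X s ∉ P) :
    idealJ (lexIdeal K c) P = lexIdeal K (c.filter (· < s)) := by
  apply le_antisymm
  · rintro f ⟨g, hg, hfg⟩
    refine mem_lexIdeal_of_mul_mem (r := s) (fun i hi => ?_) (fun h => hg (hP h))
      (lexIdeal_mono (filter_lt_le c s) hfg)
    exact Finsupp.filter_apply_neg _ _ (not_lt.2 (Fin.le_def.2 hi))
  · rw [lexIdeal, Ideal.span_le]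
    rintro _ ⟨v, hv, rfl⟩
    -- If `v` agrees with `c` before `s`, this power makes entry `s` exceed `c s`; if `v` already
    -- wins earlier, it does no harm.
    refine ⟨X s ^ (c s + 1), fun h => hs (Ideal.IsPrime.mem_of_pow_mem ‹_› _ h), ?_⟩
    rw [X_pow_eq_monomial, monomial_mul, one_mul, monomial_mem_lexIdeal, toLex_le_iff]
    right
    have hcf : ∀ j < s, c.filter (· < s) j = c j := fun j hj => Finsupp.filter_apply_pos _ _ hj
    have hcs : ∀ j, ¬ j < s → c.filter (· < s) j = 0 :=
      fun j hj => Finsupp.filter_apply_neg _ _ hj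
    have agree : (∀ j < s, c j = v j) →
        ∃ i, (∀ j < i, c j = (v + Finsupp.single s (c s + 1)) j) ∧
          c i < (v + Finsupp.single s (c s + 1)) i := fun h =>
      ⟨s, fun j hj => by simp [h j hj, Finsupp.single_eq_of_ne hj.ne],
        by simp only [Finsupp.add_apply, Finsupp.single_eq_same]; omega⟩
    rcases toLex_le_iff.1 hv with rfl | ⟨i, hi, hlt⟩
    · exact agree fun j hj => (hcf j hj).symm
    · by_cases his : i < s
      · refine ⟨i, fun j hj => ?_, ?_⟩
        · rw [← hcf j (hj.trans his), hi j hj]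
          simp [Finsupp.single_eq_of_ne (hj.trans his).ne]
        · rw [← hcf i his]
          exact hlt.trans_le (by simp)
      · exact agree fun j hj => by rw [← hcf j hj, hi j (hj.trans_le (not_lt.1 his))]

end LexIdeal

/-! ### Depth of a lex ideal -/

section Depth

variable {c : Fin n →₀ ℕ}

/-- The prime annihilates the class of the monomial `c - e_k`: raising any entry up to `k` reaches
`c` or beyond, while later variables cannot affect the comparison with `c`. -/
theorem varsLT_mem_associatedPrimes {k : Fin n} (hk : c k ≠ 0) (hc : ∀ i, k < i → c i = 0) :
    varsLT K n (k + 1) ∈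
      associatedPrimes (MvPolynomial (Fin n) K) (MvPolynomial (Fin n) K ⧸ lexIdeal K c) := by
  classical
  let a := c - Finsupp.single k 1
  have ha : ∀ i, i ≠ k → a i = c i := fun i hi => by
    simp [a, Finsupp.single_eq_of_ne hi]
  have hak : a k + 1 = c k := by
    simp only [a, Finsupp.tsub_apply, Finsupp.single_eq_same]; omega
  have hc' : ∀ i : Fin n, (k : ℕ) + 1 ≤ i → c i = 0 := fun i hi => hc i (Fin.lt_def.2 (by omega))
  have hmem : ∀ f, f ∈ (⊥ : Submodule (MvPolynomial (Fin n) K)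
      (MvPolynomial (Fin n) K ⧸ lexIdeal K c)).colon {Ideal.Quotient.mk _ (monomial a 1)} ↔
      f * monomial a 1 ∈ lexIdeal K c := fun f => by
    rw [Submodule.mem_colon_singleton, Submodule.mem_bot, ← Ideal.Quotient.eq_zero_iff_mem,
      map_mul]
    rfl
  refine isAssociatedPrime_iff.2 ⟨inferInstance, Ideal.Quotient.mk _ (monomial a 1),
    le_antisymm (varsLT_le_iff.2 fun i hi => ?_) fun f hf => mem_varsLT.2 fun m hm => ?_⟩
  · rw [hmem, X, monomial_mul, one_mul, monomial_mem_lexIdeal, toLex_le_iff]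
    rcases lt_or_eq_of_le (Fin.le_def.2 (Nat.lt_succ_iff.1 hi)) with hik | rfl
    · refine Or.inr ⟨i, fun j hj => ?_, ?_⟩
      · simp [ha j (hj.trans hik).ne, Finsupp.single_eq_of_ne hj.ne]
      · simp [ha i hik.ne]
    · left
      ext j
      by_cases hj : j = i
      · subst hj
        simp [← hak, add_comm]
      · simp [ha j hj, Finsupp.single_eq_of_ne hj]
  · rw [hmem] at hf
    by_contra! hm0
    have h1 : m + a ∈ (f * monomial a (1 : K)).support := by
      rw [mem_support_iff, coeff_mul_monomial, mul_one]
      exact mem_support_iff.1 hm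
    have h2 : toLex c ≤ toLex a :=
      toLex_le_congr hc' (fun i hi => by simp [hm0 i hi]) (mem_lexIdeal.1 hf _ h1)
    have h3 : a ≤ c := tsub_le_self
    have h4 : c = a := toLex_inj.1 (le_antisymm h2 (toLex_le_of_le h3))
    rw [← h4] at hak
    omega

theorem depthQuot_lexIdeal_le {k : Fin n} (hk : c k ≠ 0) (hc : ∀ i, k < i → c i = 0) :
    depthQuot (lexIdeal K c) ≤ (n - (k + 1) : ℕ) := by
  refine iSup₂_le fun rs hrs => ?_
  have h1 := length_le_coheight_of_isWeaklyRegular rs (varsLT_mem_associatedPrimes (K := K) hk hc)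
    (varsLT_le_idealOfVars _) hrs.1 hrs.2.toIsWeaklyRegular
  have h2 := add_coheight_varsLT_le (K := K) (n := n) (k + 1) k.2
  have h3 : ((k + 1 + rs.length : ℕ) : ℕ∞) ≤ n := by
    rw [Nat.cast_add]
    exact le_trans (by gcongr) h2
  have h4 : k + 1 + rs.length ≤ n := by exact_mod_cast h3
  exact_mod_cast (by omega : rs.length ≤ n - (k + 1))

theorem mk_mem_smul_top_iff {R : Type*} [CommRing R] (I J : Ideal R) (f : R) :
    Submodule.Quotient.mk f ∈ (I • ⊤ : Submodule R (R ⧸ J)) ↔ f ∈ J ⊔ I := by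
  have h : (I • ⊤ : Submodule R (R ⧸ J)) = Submodule.map J.mkQ I := by
    rw [← Submodule.range_mkQ, ← Submodule.map_top, ← Submodule.map_smul'', smul_eq_mul,
      Ideal.mul_top]
  rw [h, ← Submodule.comap_map_mkQ]
  rfl

theorem mem_lexIdeal_sup_span_X {s : Set (Fin n)} {f : MvPolynomial (Fin n) K} :
    f ∈ lexIdeal K c ⊔ Ideal.span (X '' s) ↔
      ∀ m ∈ f.support, toLex c ≤ toLex m ∨ ∃ i ∈ s, m i ≠ 0 := by
  have h : (X '' s : Set (MvPolynomial (Fin n) K)) =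
      (fun a => monomial a (1 : K)) '' ((fun i => Finsupp.single i 1) '' s) := by
    rw [Set.image_image]; rfl
  rw [lexIdeal, h, ← Ideal.span_union, ← Set.image_union, mem_ideal_span_monomial_image]
  refine forall₂_congr fun m _ => ⟨?_, ?_⟩
  · rintro ⟨v, hv | ⟨i, hi, rfl⟩, hvm⟩
    · exact Or.inl (le_trans hv (toLex_le_of_le hvm))
    · refine Or.inr ⟨i, hi, ?_⟩
      have := hvm i
      simp only [Finsupp.single_eq_same] at this
      omega
  · rintro (h | ⟨i, hi, hm⟩)
    · exact ⟨m, Or.inl h, le_rfl⟩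
    · refine ⟨_, Or.inr ⟨i, hi, rfl⟩, ?_⟩
      rw [Finsupp.single_le_iff]
      omega

/-- The variables from index `r` on form a regular sequence, since the comparison with `c` ignores
their exponents. `c ≠ 0` keeps the quotient nonzero. -/
theorem le_depthQuot_lexIdeal (hc0 : c ≠ 0) {r : ℕ} (hc : ∀ i : Fin n, r ≤ i → c i = 0) :
    ((n - r : ℕ) : ℕ∞) ≤ depthQuot (lexIdeal K c) := by
  classical
  let L : List (MvPolynomial (Fin n) K) := List.ofFn fun j : Fin (n - r) => X ⟨r + j, by omega⟩
  have hL : L.length = n - r := List.length_ofFn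
  have htake : ∀ k, k ≤ n - r → Ideal.ofList (L.take k) =
      Ideal.span (X '' {i : Fin n | r ≤ (i : ℕ) ∧ (i : ℕ) < r + k}) := by
    intro k hk
    rw [Ideal.ofList]
    congr 1
    ext x
    simp only [Set.mem_ofPred_eq, List.mem_take_iff_getElem, Set.mem_image]
    constructor
    · rintro ⟨j, hj, rfl⟩
      refine ⟨⟨r + j, by omega⟩, ⟨by simp, by simp; omega⟩, ?_⟩
      simp [L]
    · rintro ⟨i, ⟨hi1, hi2⟩, rfl⟩
      refine ⟨i - r, by omega, ?_⟩
      simp [L, Nat.add_sub_cancel' hi1]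
  have hreg : RingTheory.Sequence.IsRegular (MvPolynomial (Fin n) K ⧸ lexIdeal K c) L := by
    refine ⟨⟨fun k hk => ?_⟩, fun htop => ?_⟩
    · have hkr : k < n - r := hL ▸ hk
      rw [isSMulRegular_quotient_iff_mem_of_smul_mem]
      intro y hy
      obtain ⟨f, rfl⟩ := Submodule.Quotient.mk_surjective _ y
      rw [← Submodule.Quotient.mk_smul, mk_mem_smul_top_iff, htake k hkr.le,
        mem_lexIdeal_sup_span_X] at hy
      rw [mk_mem_smul_top_iff, htake k hkr.le, mem_lexIdeal_sup_span_X]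
      intro m hm
      have hLk : L[k] = X (⟨r + k, by omega⟩ : Fin n) := by simp [L]
      have hmem : m + Finsupp.single (⟨r + k, by omega⟩ : Fin n) 1 ∈ (L[k] • f).support := by
        rw [hLk, smul_eq_mul, mul_comm, mem_support_iff, coeff_mul_X]
        exact mem_support_iff.1 hm
      have hne : ∀ i : Fin n, (i : ℕ) < r + k →
          (m + (Finsupp.single ⟨r + k, by omega⟩ 1 : Fin n →₀ ℕ)) i = m i := fun i hi => by
        rw [Finsupp.add_apply, Finsupp.single_eq_of_ne (Fin.ne_of_lt (Fin.lt_def.2 hi)), add_zero]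
      rcases hy _ hmem with h | ⟨i, hi, h⟩
      · exact Or.inl (toLex_le_congr hc (fun i hi => hne i (by omega)) h)
      · exact Or.inr ⟨i, hi, by rwa [hne i hi.2] at h⟩
    · have h1 : Submodule.Quotient.mk (1 : MvPolynomial (Fin n) K) ∈
          (Ideal.ofList L • ⊤ : Submodule _ (MvPolynomial (Fin n) K ⧸ lexIdeal K c)) :=
        htop ▸ Submodule.mem_top
      have h2 := htake (n - r) le_rfl
      rw [List.take_of_length_le hL.le] at h2
      rw [mk_mem_smul_top_iff, h2, mem_lexIdeal_sup_span_X] at h1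
      rcases h1 0 (by simp) with h | ⟨i, -, h⟩
      · exact hc0 (toLex_inj.1 (le_antisymm h (toLex_le_of_le zero_le)))
      · simp at h
  have hLm : ∀ x ∈ L, x ∈ idealOfVars (Fin n) K := by
    intro x hx
    obtain ⟨j, rfl⟩ := (List.mem_ofFn' _ _).1 hx
    exact Ideal.subset_span (Set.mem_range_self _)
  rw [← hL]
  exact le_iSup₂_of_le (f := fun (rs : List (MvPolynomial (Fin n) K)) _ => (rs.length : ℕ∞)) L
    ⟨hLm, hreg⟩ le_rfl

end Depth

/-! ### Minimal generators of a lex ideal -/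

section Generators

variable {c : Fin n →₀ ℕ}

/-- The exponent vector `(a₁, …, aⱼ₋₁, aⱼ + 1, 0, …, 0)`. -/
noncomputable def succAt (a : Fin n →₀ ℕ) (j : Fin n) : Fin n →₀ ℕ :=
  a.filter (· < j) + Finsupp.single j (a j + 1)

theorem succAt_of_lt {a : Fin n →₀ ℕ} {i j : Fin n} (h : i < j) : succAt a j i = a i := by
  rw [succAt, Finsupp.add_apply, Finsupp.single_eq_of_ne h.ne, add_zero]
  exact Finsupp.filter_apply_pos (· < j) a h

theorem succAt_self (a : Fin n →₀ ℕ) (j : Fin n) : succAt a j j = a j + 1 := by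
  rw [succAt, Finsupp.add_apply, Finsupp.single_eq_same]
  simp

theorem succAt_of_gt {a : Fin n →₀ ℕ} {i j : Fin n} (h : j < i) : succAt a j i = 0 := by
  rw [succAt, Finsupp.add_apply, Finsupp.single_eq_of_ne h.ne', add_zero]
  exact Finsupp.filter_apply_neg (· < j) a h.not_gt

/-- Entry `i` is `a i + 1` on the left, but only `a i` or `0` on the right when `i ≠ j`. -/
theorem eq_of_succAt_le {a : Fin n →₀ ℕ} {i j : Fin n} (h : succAt a i ≤ succAt a j) : i = j := by
  have hi := h i
  rw [succAt_self] at hi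
  rcases lt_trichotomy i j with hij | hij | hij
  · rw [succAt_of_lt hij] at hi; omega
  · exact hij
  · rw [succAt_of_gt hij] at hi; omega

/-- If `m` first exceeds `c` at `i ≤ k`, the vector for `j = i` divides it; otherwise `c` itself
does, which is the case `j = k`. -/
theorem toLex_le_iff_exists_succAt_le {k : Fin n} (hk : c k ≠ 0) (hc : ∀ i, k < i → c i = 0)
    {m : Fin n →₀ ℕ} :
    toLex c ≤ toLex m ↔ ∃ j ≤ k, succAt (c - Finsupp.single k 1) j ≤ m := by
  set a := c - Finsupp.single k 1 with ha_def
  have ha : ∀ i, i ≠ k → a i = c i := fun i hi => by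
    simp [a, Finsupp.single_eq_of_ne hi]
  have hak : a k + 1 = c k := by
    simp only [a, Finsupp.tsub_apply, Finsupp.single_eq_same]; omega
  have hac : ∀ i, a i ≤ c i := fun i => by simp [a]
  have hsk : succAt a k = c := by
    ext i
    rcases lt_trichotomy i k with h | rfl | h
    · rw [succAt_of_lt h, ha i h.ne]
    · rw [succAt_self, hak]
    · rw [succAt_of_gt h, hc i h]
  constructor
  · intro h
    rcases toLex_le_iff.1 h with rfl | ⟨i, hi, hlt⟩
    · exact ⟨k, le_rfl, hsk.le⟩
    · rcases le_or_gt i k with hik | hik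
      · refine ⟨i, hik, fun j => ?_⟩
        rcases lt_trichotomy j i with h | rfl | h
        · rw [succAt_of_lt h, ← hi j h]; exact hac j
        · rw [succAt_self]; have := hac j; omega
        · rw [succAt_of_gt h]; exact Nat.zero_le _
      · refine ⟨k, le_rfl, hsk.trans_le fun j => ?_⟩
        rcases lt_or_ge j i with h | h
        · exact (hi j h).le
        · rw [hc j (hik.trans_le h)]; exact Nat.zero_le _
  · rintro ⟨j, hjk, hjm⟩
    refine le_trans ?_ (toLex_le_of_le hjm)
    rcases lt_or_eq_of_le hjk with h | rfl
    · refine toLex_le_iff.2 (Or.inr ⟨j, fun i hi => ?_, ?_⟩)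
      · rw [succAt_of_lt hi, ha i (hi.trans h).ne]
      · rw [succAt_self, ha j h.ne]; exact Nat.lt_succ_self _
    · rw [hsk]

theorem ncard_minGens_lexIdeal {k : Fin n} (hk : c k ≠ 0) (hc : ∀ i, k < i → c i = 0) :
    (minGens (lexIdeal K c)).ncard = k + 1 := by
  have hmem : ∀ m, monomial m (1 : K) ∈ lexIdeal K c ↔
      ∃ j ≤ k, succAt (c - Finsupp.single k 1) j ≤ m := fun m => by
    rw [monomial_mem_lexIdeal, toLex_le_iff_exists_succAt_le hk hc]
  have h : minGens (lexIdeal K c) = succAt (c - Finsupp.single k 1) '' Set.Iic k := by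
    ext m
    simp only [minGens, hmem, Set.mem_ofPred_eq, Set.mem_image, Set.mem_Iic]
    constructor
    · intro hm
      obtain ⟨j, hj, hjm⟩ := hm.prop
      exact ⟨j, hj, le_antisymm hjm (hm.le_of_le ⟨j, hj, le_rfl⟩ hjm)⟩
    · rintro ⟨j, hj, rfl⟩
      refine ⟨⟨j, hj, le_rfl⟩, ?_⟩
      rintro b ⟨i, hi, hib⟩ hbj
      have := eq_of_succAt_le (hib.trans hbj)
      subst this
      exact hib
  rw [h, Set.ncard_image_of_injective _ fun i j hij => eq_of_succAt_le hij.le,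
    Set.ncard_eq_toFinset_card']
  simp

end Generators

/-! ### Universal lexsegment ideals are lex ideals -/

section Structure

variable {I : Ideal (MvPolynomial (Fin n) K)}

theorem IsMonomial.mem_iff (hI : IsMonomial I) {f : MvPolynomial (Fin n) K} :
    f ∈ I ↔ ∀ m ∈ f.support, monomial m (1 : K) ∈ I := by
  classical
  obtain ⟨A, rfl⟩ := hI
  rw [mem_ideal_span_monomial_image]
  refine forall₂_congr fun m _ => ?_
  rw [mem_ideal_span_monomial_image]
  simp [support_monomial]

/-- The exponent vector `(u₁, …, uₙ, k)`. -/
noncomputable def extendVec (u : Fin n →₀ ℕ) (k : ℕ) : Fin (n + 1) →₀ ℕ :=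
  u.mapDomain (Fin.castAdd 1) + Finsupp.single (Fin.last n) k

theorem extendVec_castSucc (u : Fin n →₀ ℕ) (k : ℕ) (i : Fin n) :
    extendVec u k i.castSucc = u i := by
  rw [extendVec, Finsupp.add_apply, Finsupp.single_eq_of_ne (Fin.castSucc_ne_last i), add_zero]
  exact Finsupp.mapDomain_apply (Fin.castAdd_injective n 1) u i

theorem degree_extendVec (u : Fin n →₀ ℕ) (k : ℕ) : (extendVec u k).degree = u.degree + k := by
  rw [extendVec, map_add, Finsupp.degree_mapDomain, Finsupp.degree_single]

theorem monomial_extendVec (u : Fin n →₀ ℕ) (k : ℕ) :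
    monomial (extendVec u k) (1 : K) =
      rename (Fin.castAdd 1) (monomial u (1 : K)) * X (Fin.last n) ^ k := by
  rw [rename_monomial, X_pow_eq_monomial, monomial_mul, one_mul, extendVec]

theorem monomial_mem_of_extendVec_mem {u : Fin n →₀ ℕ} {k : ℕ}
    (h : monomial (extendVec u k) (1 : K) ∈
      I.map (rename (R := K) (Fin.castAdd 1 : Fin n → Fin (n + 1)))) :
    monomial u (1 : K) ∈ I := by
  -- Setting the extra variable to 1 retracts the extended ideal onto `I`.
  let ψ : MvPolynomial (Fin (n + 1)) K →ₐ[K] MvPolynomial (Fin n) K :=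
    aeval (Fin.snoc (α := fun _ => MvPolynomial (Fin n) K) X 1)
  have hψ : ∀ f, ψ (rename (Fin.castAdd 1) f) = f := by
    intro f
    have : ψ.comp (rename (Fin.castAdd 1)) = AlgHom.id K (MvPolynomial (Fin n) K) := by
      ext i
      simp only [ψ, AlgHom.comp_apply, rename_X, aeval_X, AlgHom.id_apply]
      exact congrArg _ (Fin.snoc_castSucc (α := fun _ => MvPolynomial (Fin n) K) 1 X i)
    exact DFunLike.congr_fun this f
  have hle : I.map (rename (R := K) (Fin.castAdd 1 : Fin n → Fin (n + 1))) ≤ I.comap ψ :=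
    Ideal.map_le_iff_le_comap.2 fun f hf => by
      rw [Ideal.mem_comap, Ideal.mem_comap, hψ]; exact hf
  have h1 := hle h
  have hlast : ψ (X (Fin.last n)) = 1 := by
    simp [ψ]
  rwa [Ideal.mem_comap, monomial_extendVec, map_mul, map_pow, hψ, hlast, one_pow, mul_one] at h1

/-- The monomials in a universal lexsegment ideal are closed upwards under the lexicographic
order, even across degrees. -/
theorem IsUniversalLexsegment.monomial_mem (hI : IsUniversalLexsegment I) {u v : Fin n →₀ ℕ}
    (huv : toLex u ≤ toLex v) (hu : monomial u (1 : K) ∈ I) : monomial v (1 : K) ∈ I := by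
  rcases toLex_le_iff.1 huv with rfl | ⟨i, hi, hlt⟩
  · exact hu
  -- Padding each monomial by the degree of the other equalizes degrees; the new variable comes
  -- last, so the lex comparison is still decided at `i`.
  · refine monomial_mem_of_extendVec_mem (k := u.degree)
      ((hI.2 1).2 (extendVec u v.degree) (extendVec v u.degree) ?_ ?_ ?_)
    · rw [degree_extendVec, degree_extendVec, add_comm]
    · refine Finsupp.Lex.lt_iff.2 ⟨i.castSucc, fun j hj => ?_, ?_⟩
      · obtain ⟨j, rfl⟩ := Fin.eq_castSucc_of_ne_last (hj.trans (Fin.castSucc_lt_last i)).ne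
        change extendVec u _ j.castSucc = extendVec v _ j.castSucc
        rw [extendVec_castSucc, extendVec_castSucc]
        exact hi j (Fin.castSucc_lt_castSucc_iff.1 hj)
      · change extendVec u _ i.castSucc < extendVec v _ i.castSucc
        rwa [extendVec_castSucc, extendVec_castSucc]
    · rw [monomial_extendVec]
      exact Ideal.mul_mem_right _ _ (Ideal.mem_map_of_mem _ hu)

theorem IsUniversalLexsegment.eq_bot_or_eq_lexIdeal (hI : IsUniversalLexsegment I) :
    I = ⊥ ∨ ∃ c, I = lexIdeal K c := by
  rcases Set.eq_empty_or_nonempty {u : Lex (Fin n →₀ ℕ) | monomial (ofLex u) (1 : K) ∈ I}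
    with h | h
  · left
    rw [eq_bot_iff]
    intro f hf
    rw [Ideal.mem_bot, ← support_eq_empty, Finset.eq_empty_iff_forall_notMem]
    intro m hm
    exact (Set.eq_empty_iff_forall_notMem.1 h) (toLex m) (hI.1.mem_iff.1 hf m hm)
  · right
    obtain ⟨c, hc, hmin⟩ := WellFounded.has_min
      (wellFounded_lt (α := Lex (Fin n →₀ ℕ))) _ h
    refine ⟨ofLex c, Ideal.ext fun f => ?_⟩
    rw [hI.1.mem_iff, mem_lexIdeal]
    refine forall₂_congr fun m _ => ⟨fun hm => not_lt.1 (hmin (toLex m) hm), fun hm => ?_⟩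
    exact hI.monomial_mem hm hc

end Structure

/-! ### The zero ideal and the main theorem -/

theorem idealJ_bot {R : Type*} [CommRing R] [IsDomain R] (P : Ideal R) [P.IsPrime] :
    idealJ ⊥ P = ⊥ := by
  rw [eq_bot_iff]
  rintro f ⟨g, hg, hfg⟩
  rcases mul_eq_zero.1 (Ideal.mem_bot.1 hfg) with h | h
  · exact h
  · exact absurd (h ▸ P.zero_mem) hg

theorem minGens_bot : minGens (⊥ : Ideal (MvPolynomial (Fin n) K)) = ∅ :=
  Set.eq_empty_iff_forall_notMem.2 fun a ha => by
    have h : monomial a (1 : K) = 0 :=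
      Ideal.mem_bot.1 (Minimal.prop (P := fun b => monomial b (1 : K) ∈ ⊥) ha)
    simp at h

theorem ne_zero_of_lexIdeal_ne_top {c : Fin n →₀ ℕ} (h : lexIdeal K c ≠ ⊤) : c ≠ 0 := by
  rintro rfl
  refine h ((Ideal.eq_top_iff_one _).2 ?_)
  exact mem_lexIdeal.2 fun m _ => toLex_le_of_le zero_le

theorem exists_last_ne_zero {c : Fin n →₀ ℕ} (hc : c ≠ 0) :
    ∃ k, c k ≠ 0 ∧ ∀ i, k < i → c i = 0 := by
  have hne : c.support.Nonempty := Finsupp.support_nonempty_iff.2 hc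
  refine ⟨c.support.max' hne, Finsupp.mem_support_iff.1 (c.support.max'_mem hne), fun i hi => ?_⟩
  by_contra h
  exact hi.not_ge (c.support.le_max' i (Finsupp.mem_support_iff.2 h))

end LexIdeal

theorem corollary3p8 {K : Type*} [Field K] (n : ℕ) (I P : Ideal (MvPolynomial (Fin n) K))
    (hI : LexIdeal.IsUniversalLexsegment I) [hP : P.IsPrime] (hPmon : LexIdeal.IsMonomial P)
    (hIP : I ≤ P) :
    LexIdeal.depthQuot I ≤ LexIdeal.depthQuot (LexIdeal.idealJ I P) ∧
      (LexIdeal.depthQuot I = LexIdeal.depthQuot (LexIdeal.idealJ I P) ↔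
        ∀ i : ℕ, i < (LexIdeal.minGens I).ncard →
          ∃ hi : i < n, (MvPolynomial.X ⟨i, hi⟩ : MvPolynomial (Fin n) K) ∈ P) := by
  open LexIdeal in
  rcases hI.eq_bot_or_eq_lexIdeal with rfl | ⟨c, rfl⟩
  · simp [idealJ_bot, minGens_bot]
  · have hc0 := ne_zero_of_lexIdeal_ne_top (ne_top_of_le_ne_top hP.ne_top hIP)
    obtain ⟨k, hk, hc⟩ := exists_last_ne_zero hc0
    rw [ncard_minGens_lexIdeal hk hc]
    by_cases hall : ∀ i : Fin n, i ≤ k → (MvPolynomial.X i : MvPolynomial (Fin n) K) ∈ P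
    · have hJ : idealJ (lexIdeal K c) P = lexIdeal K c :=
        idealJ_lexIdeal_eq_self (r := k + 1) (fun i hi => hc i (Fin.lt_def.2 (by omega)))
          (varsLT_le_iff.2 fun i hi => hall i (Fin.le_def.2 (by omega)))
      rw [hJ]
      exact ⟨le_rfl, fun _ i hi => ⟨by omega, hall _ (Fin.le_def.2 (Nat.lt_succ_iff.1 hi))⟩,
        fun _ => rfl⟩
    · push Not at hall
      obtain ⟨s, ⟨hsk, hs⟩, hmin⟩ := WellFounded.has_min (wellFounded_lt (α := Fin n))
        {i | i ≤ k ∧ (MvPolynomial.X i : MvPolynomial (Fin n) K) ∉ P} hall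
      have hJ : idealJ (lexIdeal K c) P = lexIdeal K (c.filter (· < s)) := by
        refine idealJ_lexIdeal_eq_filter (varsLT_le_iff.2 fun i hi => ?_) hs
        by_contra h
        exact hmin i ⟨(Fin.lt_def.2 hi).le.trans hsk, h⟩ hi
      -- `J(I, P) ⊆ P` is proper, so the truncation of `c` cannot vanish.
      have hJ0 : c.filter (· < s) ≠ 0 := ne_zero_of_lexIdeal_ne_top (K := K)
        (hJ ▸ ne_top_of_le_ne_top hP.ne_top (idealJ_le hIP))
      have hlt : depthQuot (lexIdeal K c) < depthQuot (idealJ (lexIdeal K c) P) := by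
        rw [hJ]
        refine (depthQuot_lexIdeal_le hk hc).trans_lt (lt_of_lt_of_le ?_
          (le_depthQuot_lexIdeal hJ0 (r := s) fun i hi =>
            Finsupp.filter_apply_neg (· < s) c (not_lt.2 (Fin.le_def.2 hi))))
        have := Fin.le_def.1 hsk
        exact_mod_cast (by omega : n - ((k : ℕ) + 1) < n - s)
      refine ⟨hlt.le, fun h => absurd h hlt.ne, fun h => ?_⟩
      obtain ⟨_, hX⟩ := h s (Nat.lt_succ_iff.2 (Fin.le_def.1 hsk))
      exact absurd hX hs
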